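/- Let $A$ be a non-empty set. Let $FVL(A)$ be the free vector lattice over $A$, realised as the vector sublattice of $\mathbb{R}^{\mathbb{R}^A}$ generated by the coordinate functions $\delta_a(\xi)=\xi(a)$ ($a\in A$), with the norm $$\|f\|_F=\sup\{\varphi(|f|) : \varphi \text{ a positive linear functional on } FVL(A),\ \varphi(|\delta_a|)\le 1 \text{ for all } a\in A\},$$ and let $FBL(A)$, the free Banach lattice over $A$, be the completion of $(FVL(A),\|\cdot\|_F)$. (It is characterised by the universal property that every bounded map $\kappa$ from $A$ to a Banach lattice $Y$ extends uniquely to a lattice homomorphism $T:FBL(A)\to Y$ with $T\delta_a=\kappa(a)$ for $a\in A$ and $\|T\|=\sup_a\|\kappa(a)\|$.) Let $\Delta_A=[-1,1]^A$ with the product topology, and let $H(\Delta_A)$ be the Banach lattice, with pointwise operations and supremum norm $\|\cdot\|_\infty$, of all continuous $f:\Delta_A\to\mathbb{R}$ with $f(t\xi)=tf(\xi)$ for $\xi\in\Delta_A$, $t\in[0,1]$. Let $J:FBL(A)\to H(\Delta_A)$ be the continuous extension of the restriction map $f\mapsto f|_{\Delta_A}$ on $FVL(A)$. Then: 1. A linear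 functional $\omega:FBL(A)\to\mathbb{R}$ is a lattice homomorphism if and only if there are $\xi\in\Delta_A$ and a real $\lambda\ge 0$ such that $\omega(f)=\lambda\,(Jf)(\xi)$ for all $f\in FBL(A)$. 2. The real-valued lattice homomorphisms on $FBL(A)$ separate its points. 3. $J$ is an injective lattice homomorphism; its range is a vector sublattice of $H(\Delta_A)$ and $Jf\le Jg$ if and only if $f\le g$, so that $FBL(A)$ is linearly order isomorphic to a vector sublattice of $H(\Delta_A)$. 4. If $A$ is finite with $n$ elements, then $J$ is a bijective linear homeomorphism of $FBL(A)$ onto $H(\Delta_A)$ (so, by 3, a surjective norm and lattice isomorphism), and $\|Jf\|_\infty\le\|f\|_F\le n\|Jf\|_\infty$ for all $f\in FBL(A)$. -/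

import Mathlib

universe u v

noncomputable section

namespace FreeBanachLattice

open Set Topology

set_option linter.unusedSectionVars false
set_option linter.unusedVariables false

section General

variable {E : Type*} [AddCommGroup E] [Module ℝ E] [Lattice E]
variable {F : Type*} [AddCommGroup F] [Module ℝ F] [Lattice F]

/-- A linear map between vector lattices is a (vector) lattice homomorphism when it preserves
binary suprema and infima. -/
structure IsLatticeHom (T : E →ₗ[ℝ] F) : Prop where
  map_sup : ∀ x y, T (x ⊔ y) = T x ⊔ T y
  map_inf : ∀ x y, T (x ⊓ y) = T x ⊓ T y

/-- The vector sublattice of `E` generated by a set `s`: the smallest linear subspace of `E`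
that contains `s` and is closed under binary suprema and infima. -/
def vectorLatticeClosure (s : Set E) : Submodule ℝ E :=
  sInf {p : Submodule ℝ E | s ⊆ (p : Set E) ∧ IsSublattice (p : Set E)}

theorem subset_vectorLatticeClosure (s : Set E) : s ⊆ (vectorLatticeClosure s : Set E) := by
  intro x hx
  simp only [vectorLatticeClosure, Submodule.coe_sInf, mem_iInter]
  exact fun p hp => hp.1 hx

theorem isSublattice_vectorLatticeClosure (s : Set E) :
    IsSublattice (vectorLatticeClosure s : Set E) := by
  simp only [vectorLatticeClosure, Submodule.coe_sInf]
  exact ⟨fun x hx y hy => mem_iInter₂.2 fun p hp =>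
      hp.2.supClosed (mem_iInter₂.1 hx p hp) (mem_iInter₂.1 hy p hp),
    fun x hx y hy => mem_iInter₂.2 fun p hp =>
      hp.2.infClosed (mem_iInter₂.1 hx p hp) (mem_iInter₂.1 hy p hp)⟩

theorem vectorLatticeClosure_le {s : Set E} {p : Submodule ℝ E} (hs : s ⊆ (p : Set E))
    (hp : IsSublattice (p : Set E)) : vectorLatticeClosure s ≤ p :=
  sInf_le ⟨hs, hp⟩

end General

section FVL

variable (A : Type u)

/-- The coordinate function `ξ ↦ ξ a` on `ℝ^A`. -/
def coord (a : A) : (A → ℝ) → ℝ := fun ξ => ξ a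

/-- The free vector lattice over `A`: the vector sublattice of the real functions on `ℝ^A`
(with pointwise operations) that is generated by the coordinate functions. -/
def FVL : Type u := vectorLatticeClosure (Set.range (coord A))

namespace FVL

instance : AddCommGroup (FVL A) :=
  inferInstanceAs (AddCommGroup (vectorLatticeClosure (Set.range (coord A))))

instance : Module ℝ (FVL A) :=
  inferInstanceAs (Module ℝ (vectorLatticeClosure (Set.range (coord A))))

/-- The lattice operations and the order are the pointwise ones. -/
instance : Lattice (FVL A) :=
  Subtype.lattice (P := fun f => f ∈ vectorLatticeClosure (Set.range (coord A)))
    (fun _ _ hx hy => (isSublattice_vectorLatticeClosure _).supClosed hx hy)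
    (fun _ _ hx hy => (isSublattice_vectorLatticeClosure _).infClosed hx hy)

variable {A}

/-- The function on `ℝ^A` underlying an element of `FVL A`. -/
def eval (f : FVL A) : (A → ℝ) → ℝ := f.1

/-- The free generators of `FVL A`. -/
def gen (a : A) : FVL A := ⟨coord A a, subset_vectorLatticeClosure _ ⟨a, rfl⟩⟩

@[simp] theorem eval_gen (a : A) (ξ : A → ℝ) : (gen a).eval ξ = ξ a := rfl
@[simp] theorem eval_zero (ξ : A → ℝ) : (0 : FVL A).eval ξ = 0 := rfl
@[simp] theorem eval_add (f g : FVL A) (ξ : A → ℝ) : (f + g).eval ξ = f.eval ξ + g.eval ξ := rfl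
@[simp] theorem eval_neg (f : FVL A) (ξ : A → ℝ) : (-f).eval ξ = - f.eval ξ := rfl
@[simp] theorem eval_smul (c : ℝ) (f : FVL A) (ξ : A → ℝ) : (c • f).eval ξ = c * f.eval ξ := rfl
@[simp] theorem eval_sup (f g : FVL A) (ξ : A → ℝ) : (f ⊔ g).eval ξ = f.eval ξ ⊔ g.eval ξ := rfl
@[simp] theorem eval_inf (f g : FVL A) (ξ : A → ℝ) : (f ⊓ g).eval ξ = f.eval ξ ⊓ g.eval ξ := rfl
@[simp] theorem eval_abs (f : FVL A) (ξ : A → ℝ) : |f|.eval ξ = |f.eval ξ| := rfl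
theorem le_iff {f g : FVL A} : f ≤ g ↔ ∀ ξ, f.eval ξ ≤ g.eval ξ := Iff.rfl
theorem ext {f g : FVL A} (h : ∀ ξ, f.eval ξ = g.eval ξ) : f = g := Subtype.ext (funext h)

instance : IsOrderedAddMonoid (FVL A) where
  add_le_add_left _ _ h k := fun ξ => add_le_add_left (h ξ) (k.eval ξ)

instance : IsOrderedModule ℝ (FVL A) where
  smul_le_smul_of_nonneg_left _ hc _ _ h := fun ξ => mul_le_mul_of_nonneg_left (h ξ) hc
  smul_le_smul_of_nonneg_right _ hf _ _ h := fun ξ => mul_le_mul_of_nonneg_right h (hf ξ)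

/-- Induction on `FVL A`. -/
theorem induction {P : FVL A → Prop} (gen : ∀ a, P (gen a)) (zero : P 0)
    (add : ∀ f g, P f → P g → P (f + g)) (smul : ∀ (c : ℝ) f, P f → P (c • f))
    (sup : ∀ f g, P f → P g → P (f ⊔ g)) (inf : ∀ f g, P f → P g → P (f ⊓ g)) (f : FVL A) :
    P f := by
  let p : Submodule ℝ ((A → ℝ) → ℝ) :=
    { carrier := {f | ∃ h : f ∈ vectorLatticeClosure (Set.range (coord A)), P ⟨f, h⟩}
      zero_mem' := ⟨Submodule.zero_mem _, zero⟩
      add_mem' := fun ⟨h, hP⟩ ⟨k, kP⟩ => ⟨Submodule.add_mem _ h k, add _ _ hP kP⟩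
      smul_mem' := fun c _ ⟨h, hP⟩ => ⟨Submodule.smul_mem _ c h, smul c _ hP⟩ }
  have : vectorLatticeClosure (Set.range (coord A)) ≤ p := by
    refine vectorLatticeClosure_le ?_ ⟨?_, ?_⟩
    · rintro _ ⟨a, rfl⟩
      exact ⟨_, gen a⟩
    · rintro x ⟨h, hP⟩ y ⟨k, kP⟩
      exact ⟨_, sup _ _ hP kP⟩
    · rintro x ⟨h, hP⟩ y ⟨k, kP⟩
      exact ⟨_, inf _ _ hP kP⟩
  exact (this f.2).2

/-- Every element is dominated by a multiple of a finite sum of moduli of generators. -/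
theorem exists_finset (f : FVL A) : ∃ (B : Finset A) (C : ℝ), 0 ≤ C ∧
    |f| ≤ C • ∑ b ∈ B, |gen b| := by
  classical
  have key : ∀ (B₁ B₂ : Finset A) (C₁ C₂ : ℝ), 0 ≤ C₁ → 0 ≤ C₂ → ∀ h : FVL A,
      (∀ f g : FVL A, |f| ≤ C₁ • ∑ b ∈ B₁, |gen b| → |g| ≤ C₂ • ∑ b ∈ B₂, |gen b| →
        |h| ≤ |f| + |g| → |h| ≤ (C₁ + C₂) • ∑ b ∈ B₁ ∪ B₂, |gen b|) := by
    intro B₁ B₂ C₁ C₂ h₁ h₂ h f g hf hg hh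
    have e₁ : ∑ b ∈ B₁, |gen b| ≤ ∑ b ∈ B₁ ∪ B₂, |gen b| :=
      Finset.sum_le_sum_of_subset_of_nonneg Finset.subset_union_left (fun _ _ _ => abs_nonneg _)
    have e₂ : ∑ b ∈ B₂, |gen b| ≤ ∑ b ∈ B₁ ∪ B₂, |gen b| :=
      Finset.sum_le_sum_of_subset_of_nonneg Finset.subset_union_right (fun _ _ _ => abs_nonneg _)
    rw [add_smul]
    exact hh.trans (add_le_add (hf.trans (smul_le_smul_of_nonneg_left e₁ h₁))
      (hg.trans (smul_le_smul_of_nonneg_left e₂ h₂)))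
  induction f using FVL.induction with
  | gen a => exact ⟨{a}, 1, zero_le_one, by simp⟩
  | zero => exact ⟨∅, 0, le_rfl, by simp⟩
  | add f g hf hg =>
    obtain ⟨B₁, C₁, h₁, e₁⟩ := hf
    obtain ⟨B₂, C₂, h₂, e₂⟩ := hg
    exact ⟨B₁ ∪ B₂, C₁ + C₂, by positivity, key _ _ _ _ h₁ h₂ _ f g e₁ e₂ (abs_add_le f g)⟩
  | smul c f hf =>
    obtain ⟨B₁, C₁, h₁, e₁⟩ := hf
    refine ⟨B₁, |c| * C₁, by positivity, ?_⟩
    have : |c • f| = |c| • |f| := FVL.ext fun ξ => by simp [abs_mul]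
    rw [this, mul_smul]
    exact smul_le_smul_of_nonneg_left e₁ (abs_nonneg c)
  | sup f g hf hg =>
    obtain ⟨B₁, C₁, h₁, e₁⟩ := hf
    obtain ⟨B₂, C₂, h₂, e₂⟩ := hg
    refine ⟨B₁ ∪ B₂, C₁ + C₂, by positivity, key _ _ _ _ h₁ h₂ _ f g e₁ e₂ fun ξ => ?_⟩
    change |max (f.eval ξ) (g.eval ξ)| ≤ |f.eval ξ| + |g.eval ξ|
    exact (abs_max_le_max_abs_abs).trans (max_le_add_of_nonneg (abs_nonneg _) (abs_nonneg _))
  | inf f g hf hg =>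
    obtain ⟨B₁, C₁, h₁, e₁⟩ := hf
    obtain ⟨B₂, C₂, h₂, e₂⟩ := hg
    refine ⟨B₁ ∪ B₂, C₁ + C₂, by positivity, key _ _ _ _ h₁ h₂ _ f g e₁ e₂ fun ξ => ?_⟩
    change |min (f.eval ξ) (g.eval ξ)| ≤ |f.eval ξ| + |g.eval ξ|
    exact (abs_min_le_max_abs_abs).trans (max_le_add_of_nonneg (abs_nonneg _) (abs_nonneg _))

/-- Every element depends on finitely many coordinates. -/
theorem exists_eval_eq (f : FVL A) : ∃ B : Finset A, ∀ ξ η : A → ℝ, (∀ b ∈ B, ξ b = η b) →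
    f.eval ξ = f.eval η := by
  classical
  induction f using FVL.induction with
  | gen a => exact ⟨{a}, fun ξ η h => h a (by simp)⟩
  | zero => exact ⟨∅, fun _ _ _ => rfl⟩
  | smul c f hf =>
    obtain ⟨B, h⟩ := hf
    exact ⟨B, fun ξ η e => by simp [h ξ η e]⟩
  | add f g hf hg | sup f g hf hg | inf f g hf hg =>
    obtain ⟨B₁, h₁⟩ := hf
    obtain ⟨B₂, h₂⟩ := hg
    refine ⟨B₁ ∪ B₂, fun ξ η e => ?_⟩
    have e₁ := h₁ ξ η fun b hb => e b (Finset.mem_union_left _ hb)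
    have e₂ := h₂ ξ η fun b hb => e b (Finset.mem_union_right _ hb)
    simp [e₁, e₂]

theorem continuous_eval (f : FVL A) : Continuous f.eval := by
  induction f using FVL.induction with
  | gen a => exact continuous_apply a
  | zero => exact continuous_const
  | add f g hf hg => exact hf.add hg
  | smul c f hf => exact hf.const_smul c
  | sup f g hf hg => exact hf.sup hg
  | inf f g hf hg => exact hf.inf hg

theorem eval_pos_smul (f : FVL A) (t : ℝ) (ht : 0 ≤ t) (ξ : A → ℝ) :
    f.eval (t • ξ) = t * f.eval ξ := by
  induction f using FVL.induction with
  | gen a => simp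
  | zero => simp
  | add f g hf hg => simp [hf, hg, mul_add]
  | smul c f hf => simp [hf, mul_left_comm]
  | sup f g hf hg => simp [hf, hg, mul_max_of_nonneg _ _ ht]
  | inf f g hf hg => simp [hf, hg, mul_min_of_nonneg _ _ ht]

/-- The positive linear functionals `φ` on `FVL A` with `‖φ‖† = sup_a |φ|(|δ_a|) ≤ 1`
(for `φ ≥ 0` one has `|φ| = φ`). -/
def dualBall (A : Type u) : Set (FVL A →ₗ[ℝ] ℝ) :=
  {φ | (∀ f, 0 ≤ f → 0 ≤ φ f) ∧ ∀ a, φ |gen a| ≤ 1}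

/-- The norm `‖f‖_F = sup {φ(|f|) : φ ≥ 0, ‖φ‖† ≤ 1}` of the free Banach lattice, on `FVL A`. -/
def normF (f : FVL A) : ℝ := sSup {r | ∃ φ ∈ dualBall A, r = φ |f|}

theorem mono_of_mem {φ : FVL A →ₗ[ℝ] ℝ} (hφ : φ ∈ dualBall A) {f g : FVL A} (h : f ≤ g) :
    φ f ≤ φ g := by
  have := hφ.1 (g - f) (sub_nonneg.2 h)
  rw [map_sub] at this
  linarith

theorem bddAbove_normF (f : FVL A) : BddAbove {r | ∃ φ ∈ dualBall A, r = φ |f|} := by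
  obtain ⟨B, C, hC, h⟩ := exists_finset f
  refine ⟨C * ∑ b ∈ B, 1, ?_⟩
  rintro _ ⟨φ, hφ, rfl⟩
  refine (mono_of_mem hφ h).trans ?_
  rw [map_smul, map_sum, smul_eq_mul]
  exact mul_le_mul_of_nonneg_left (Finset.sum_le_sum fun b _ => hφ.2 b) hC

theorem le_normF {φ : FVL A →ₗ[ℝ] ℝ} (hφ : φ ∈ dualBall A) (f : FVL A) : φ |f| ≤ normF f :=
  le_csSup (bddAbove_normF f) ⟨φ, hφ, rfl⟩

theorem zero_mem_dualBall : (0 : FVL A →ₗ[ℝ] ℝ) ∈ dualBall A :=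
  ⟨fun _ _ => le_rfl, fun _ => zero_le_one⟩

theorem normF_le {f : FVL A} {r : ℝ} (h : ∀ φ ∈ dualBall A, φ |f| ≤ r) : normF f ≤ r := by
  refine csSup_le ⟨_, 0, zero_mem_dualBall, rfl⟩ ?_
  rintro _ ⟨φ, hφ, rfl⟩
  exact h φ hφ

theorem normF_nonneg (f : FVL A) : 0 ≤ normF f := le_normF zero_mem_dualBall f

/-- Evaluation at a point of `ℝ^A`, as a linear functional. -/
def evalAt (ξ : A → ℝ) : FVL A →ₗ[ℝ] ℝ where
  toFun f := f.eval ξ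
  map_add' _ _ := rfl
  map_smul' _ _ := rfl

theorem evalAt_mem_dualBall {ξ : A → ℝ} (hξ : ∀ a, |ξ a| ≤ 1) : evalAt ξ ∈ dualBall A :=
  ⟨fun _ hf => hf ξ, hξ⟩

theorem abs_eval_le_normF (f : FVL A) {ξ : A → ℝ} (hξ : ∀ a, |ξ a| ≤ 1) :
    |f.eval ξ| ≤ normF f :=
  le_normF (evalAt_mem_dualBall hξ) f

theorem eq_zero_of_normF (f : FVL A) (h : normF f = 0) : f = 0 := by
  classical
  refine FVL.ext fun ξ => ?_
  obtain ⟨B, hB⟩ := exists_eval_eq f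
  let t : ℝ := 1 + ∑ b ∈ B, |ξ b|
  have ht : 0 < t := by positivity
  let η : A → ℝ := fun a => if a ∈ B then t⁻¹ * ξ a else 0
  have hη : ∀ a, |η a| ≤ 1 := by
    intro a
    by_cases ha : a ∈ B
    · have h1 : |ξ a| ≤ t := by
        have := Finset.single_le_sum (f := fun b => |ξ b|) (fun b _ => abs_nonneg _) ha
        simp only [t]
        linarith
      simp only [η, ha, if_true, abs_mul, abs_inv, abs_of_pos ht]
      rw [inv_mul_le_iff₀ ht]
      linarith
    · simp [η, ha]
  have h1 : f.eval ξ = f.eval (t • η) := hB _ _ fun b hb => by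
    simp [η, hb, ht.ne']
  have h2 : f.eval η = 0 := by
    have := abs_eval_le_normF f hη
    rw [h] at this
    exact abs_nonpos_iff.1 this
  rw [h1, eval_pos_smul f t ht.le, h2, mul_zero, eval_zero]

/-- The group norm given by `‖·‖_F`. -/
def groupNorm (A : Type u) : AddGroupNorm (FVL A) where
  toFun := normF
  map_zero' := le_antisymm (normF_le fun φ _ => by simp) (normF_nonneg _)
  add_le' f g := normF_le fun φ hφ => by
    have := mono_of_mem hφ (abs_add_le f g)
    rw [map_add] at this
    exact this.trans (add_le_add (le_normF hφ f) (le_normF hφ g))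
  neg' f := by simp only [normF, abs_neg]
  eq_zero_of_map_eq_zero' := eq_zero_of_normF

instance : NormedAddCommGroup (FVL A) := (groupNorm A).toNormedAddCommGroup

theorem norm_def (f : FVL A) : ‖f‖ = normF f := rfl

instance : NormedSpace ℝ (FVL A) where
  norm_smul_le c f := normF_le fun φ hφ => by
    have : |c • f| = |c| • |f| := FVL.ext fun ξ => by simp [abs_mul]
    rw [this, map_smul, smul_eq_mul, Real.norm_eq_abs]
    exact mul_le_mul_of_nonneg_left (le_normF hφ f) (abs_nonneg c)

instance : HasSolidNorm (FVL A) where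
  solid f g h := normF_le fun φ hφ => (mono_of_mem hφ h).trans (le_normF hφ g)

end FVL

end FVL

section Completion

open UniformSpace

/-! The completion of a normed vector lattice is a Banach lattice. -/

variable (E : Type u) [NormedAddCommGroup E] [NormedSpace ℝ E] [Lattice E] [IsOrderedAddMonoid E]
  [IsOrderedModule ℝ E] [HasSolidNorm E]

/-- The norm completion of a normed vector lattice. -/
def BanachCompletion : Type u := Completion E

namespace BanachCompletion

instance : NormedAddCommGroup (BanachCompletion E) :=
  inferInstanceAs (NormedAddCommGroup (Completion E))

instance : NormedSpace ℝ (BanachCompletion E) :=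
  inferInstanceAs (NormedSpace ℝ (Completion E))

instance : CompleteSpace (BanachCompletion E) :=
  inferInstanceAs (CompleteSpace (Completion E))

variable {E}

/-- The embedding of a normed vector lattice into its completion. -/
def of : E →ₗᵢ[ℝ] BanachCompletion E := (Completion.toComplₗᵢ : E →ₗᵢ[ℝ] Completion E)

theorem denseRange_of : DenseRange (of : E → BanachCompletion E) :=
  Completion.denseRange_coe

theorem uniformContinuous₂_sup : UniformContinuous₂ (fun x y : E => x ⊔ y) := by
  refine Metric.uniformContinuous_iff.2 fun ε hε => ⟨ε / 2, half_pos hε, ?_⟩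
  rintro ⟨a, b⟩ ⟨c, d⟩ h
  rw [Prod.dist_eq, max_lt_iff, dist_eq_norm, dist_eq_norm] at h
  rw [dist_eq_norm]
  have := norm_sup_sub_sup_le_add_norm a b c d
  have h1 := h.1
  have h2 := h.2
  simp only [Function.uncurry] at *
  linarith

theorem uniformContinuous₂_inf : UniformContinuous₂ (fun x y : E => x ⊓ y) := by
  refine Metric.uniformContinuous_iff.2 fun ε hε => ⟨ε / 2, half_pos hε, ?_⟩
  rintro ⟨a, b⟩ ⟨c, d⟩ h
  rw [Prod.dist_eq, max_lt_iff, dist_eq_norm, dist_eq_norm] at h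
  rw [dist_eq_norm]
  have := norm_inf_sub_inf_le_add_norm a b c d
  have h1 := h.1
  have h2 := h.2
  simp only [Function.uncurry] at *
  linarith

/-- The continuous extension of `⊔` to the completion. -/
def sup' : BanachCompletion E → BanachCompletion E → BanachCompletion E :=
  (Completion.map₂ (fun x y : E => x ⊔ y) : Completion E → Completion E → Completion E)

/-- The continuous extension of `⊓` to the completion. -/
def inf' : BanachCompletion E → BanachCompletion E → BanachCompletion E :=
  (Completion.map₂ (fun x y : E => x ⊓ y) : Completion E → Completion E → Completion E)

theorem of_sup' (x y : E) : of (x ⊔ y) = sup' (of x) (of y) :=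
  (Completion.map₂_coe_coe x y _ uniformContinuous₂_sup).symm

theorem of_inf' (x y : E) : of (x ⊓ y) = inf' (of x) (of y) :=
  (Completion.map₂_coe_coe x y _ uniformContinuous₂_inf).symm

@[fun_prop]
theorem continuous_sup' {X : Type*} [TopologicalSpace X] {f g : X → BanachCompletion E}
    (hf : Continuous f) (hg : Continuous g) : Continuous fun x => sup' (f x) (g x) :=
  (Completion.uniformContinuous_map₂ (fun x y : E => x ⊔ y)).continuous.comp (hf.prodMk hg)

@[fun_prop]
theorem continuous_inf' {X : Type*} [TopologicalSpace X] {f g : X → BanachCompletion E}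
    (hf : Continuous f) (hg : Continuous g) : Continuous fun x => inf' (f x) (g x) :=
  (Completion.uniformContinuous_map₂ (fun x y : E => x ⊓ y)).continuous.comp (hf.prodMk hg)

theorem induction₁ {p : BanachCompletion E → Prop} (hp : IsClosed {x | p x})
    (h : ∀ x : E, p (of x)) (x : BanachCompletion E) : p x :=
  denseRange_of.induction_on x hp h

theorem induction₂ {p : BanachCompletion E → BanachCompletion E → Prop}
    (hp : IsClosed {x : BanachCompletion E × BanachCompletion E | p x.1 x.2})
    (h : ∀ x y : E, p (of x) (of y)) (x y : BanachCompletion E) : p x y :=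
  denseRange_of.induction_on₂ hp h x y

theorem induction₃ {p : BanachCompletion E → BanachCompletion E → BanachCompletion E → Prop}
    (hp : IsClosed {x : BanachCompletion E × BanachCompletion E × BanachCompletion E |
      p x.1 x.2.1 x.2.2})
    (h : ∀ x y z : E, p (of x) (of y) (of z)) (x y z : BanachCompletion E) : p x y z :=
  denseRange_of.induction_on₃ hp h x y z

theorem sup_comm' (x y : BanachCompletion E) : sup' x y = sup' y x :=
  induction₂ (p := fun x y => sup' x y = sup' y x)
    (isClosed_eq (by fun_prop) (by fun_prop)) (fun x y => by
      rw [← of_sup', ← of_sup', sup_comm]) x y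

theorem sup_assoc' (x y z : BanachCompletion E) : sup' (sup' x y) z = sup' x (sup' y z) :=
  induction₃ (p := fun x y z => sup' (sup' x y) z = sup' x (sup' y z))
    (isClosed_eq (by fun_prop) (by fun_prop)) (fun x y z => by
      simp only [← of_sup', sup_assoc]) x y z

theorem sup_self' (x : BanachCompletion E) : sup' x x = x :=
  induction₁ (p := fun x => sup' x x = x)
    (isClosed_eq (by fun_prop) (by fun_prop)) (fun x => by rw [← of_sup', sup_idem]) x

theorem inf_comm' (x y : BanachCompletion E) : inf' x y = inf' y x :=
  induction₂ (p := fun x y => inf' x y = inf' y x)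
    (isClosed_eq (by fun_prop) (by fun_prop)) (fun x y => by
      rw [← of_inf', ← of_inf', inf_comm]) x y

theorem inf_sup_self' (x y : BanachCompletion E) : sup' (inf' x y) x = x :=
  induction₂ (p := fun x y => sup' (inf' x y) x = x)
    (isClosed_eq (by fun_prop) (by fun_prop)) (fun x y => by
      rw [← of_inf', ← of_sup', sup_eq_right.2 inf_le_left]) x y

theorem sup_inf' (x y z : BanachCompletion E) :
    sup' x (inf' (sup' x y) (sup' x z)) = inf' (sup' x y) (sup' x z) :=
  induction₃ (p := fun x y z => sup' x (inf' (sup' x y) (sup' x z)) = inf' (sup' x y) (sup' x z))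
    (isClosed_eq (by fun_prop) (by fun_prop)) (fun x y z => by
      simp only [← of_sup', ← of_inf']
      rw [sup_eq_right.2 (le_inf le_sup_left le_sup_left)]) x y z

/-- The lattice operations are the continuous extensions of those of `E`, and
`x ≤ y` means `x ⊔ y = y`. -/
instance : Lattice (BanachCompletion E) where
  le x y := sup' x y = y
  le_refl := sup_self'
  le_trans x y z (hxy : sup' x y = y) (hyz : sup' y z = z) := by
    rw [← hyz, ← sup_assoc', hxy]
  le_antisymm x y (hxy : sup' x y = y) (hyx : sup' y x = x) := by
    rw [← hxy, sup_comm', hyx]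
  sup := sup'
  inf := inf'
  le_sup_left x y := by
    rw [← sup_assoc', sup_self']
  le_sup_right x y := by
    rw [sup_comm' x y, ← sup_assoc', sup_self']
  sup_le x y z (hx : sup' x z = z) (hy : sup' y z = z) := by
    rw [sup_assoc', hy, hx]
  inf_le_left x y := inf_sup_self' x y
  inf_le_right x y := by
    rw [inf_comm', inf_sup_self']
  le_inf x y z (hy : sup' x y = y) (hz : sup' x z = z) := by
    have := sup_inf' x y z
    rwa [hy, hz] at this

theorem of_sup (x y : E) : of (x ⊔ y) = of x ⊔ of y := of_sup' x y

theorem of_inf (x y : E) : of (x ⊓ y) = of x ⊓ of y := of_inf' x y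

instance : ContinuousSup (BanachCompletion E) :=
  ⟨continuous_sup' continuous_fst continuous_snd⟩

instance : ContinuousInf (BanachCompletion E) :=
  ⟨continuous_inf' continuous_fst continuous_snd⟩

theorem add_sup' (x y z : BanachCompletion E) : (x ⊔ y) + z = (x + z) ⊔ (y + z) :=
  induction₃ (p := fun x y z => (x ⊔ y) + z = (x + z) ⊔ (y + z))
    (isClosed_eq (by fun_prop) (by fun_prop)) (fun x y z => by
      simp only [← of_sup, ← map_add, sup_add]) x y z

theorem smul_sup' (c : ℝ) (hc : 0 ≤ c) (x y : BanachCompletion E) :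
    c • (x ⊔ y) = (c • x) ⊔ (c • y) := by
  refine induction₂ (p := fun x y => c • (x ⊔ y) = (c • x) ⊔ (c • y))
    (isClosed_eq (continuous_sup.const_smul c)
      ((continuous_fst.const_smul c).sup (continuous_snd.const_smul c))) (fun x y => ?_) x y
  have h : c • (x ⊔ y) = (c • x) ⊔ (c • y) := by
    rcases hc.eq_or_lt with rfl | hc
    · rw [zero_smul, zero_smul, zero_smul, sup_idem]
    · exact (OrderIso.smulRight hc).map_sup x y
  rw [← of_sup, ← LinearIsometry.map_smul, h, of_sup, LinearIsometry.map_smul,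
    LinearIsometry.map_smul]

instance : IsOrderedAddMonoid (BanachCompletion E) where
  add_le_add_left x y h z := by
    rw [← sup_eq_right] at h ⊢
    rw [← add_sup', h]

instance : IsOrderedModule ℝ (BanachCompletion E) where
  smul_le_smul_of_nonneg_left c hc x y h := by
    rw [← sup_eq_right] at h ⊢
    rw [← smul_sup' c hc, h]
  smul_le_smul_of_nonneg_right x hx c d h := by
    have hx' : (0 : BanachCompletion E) ⊔ x = x := sup_eq_right.2 hx
    have := smul_sup' (d - c) (sub_nonneg.2 h) 0 x
    rw [hx', smul_zero] at this
    have h0 : (0 : BanachCompletion E) ≤ (d - c) • x := sup_eq_right.1 this.symm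
    rw [sub_smul] at h0
    exact sub_nonneg.1 h0

theorem of_abs (x : E) : of |x| = |of x| := by
  change of (x ⊔ -x) = of x ⊔ -of x
  rw [of_sup, map_neg]

theorem continuous_abs' : Continuous (fun x : BanachCompletion E => |x|) := by
  change Continuous (fun x : BanachCompletion E => x ⊔ -x)
  fun_prop

instance : HasSolidNorm (BanachCompletion E) where
  solid x y h := by
    have h1 : ‖|x|‖ = ‖x‖ :=
      induction₁ (p := fun x => ‖|x|‖ = ‖x‖)
        (isClosed_eq continuous_abs'.norm continuous_norm) (fun x => by
          rw [← of_abs, LinearIsometry.norm_map, LinearIsometry.norm_map, norm_abs_eq_norm]) x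
    have h2 : ‖|y|‖ = ‖y‖ :=
      induction₁ (p := fun x => ‖|x|‖ = ‖x‖)
        (isClosed_eq continuous_abs'.norm continuous_norm) (fun x => by
          rw [← of_abs, LinearIsometry.norm_map, LinearIsometry.norm_map, norm_abs_eq_norm]) y
    have h3 : ‖|x|‖ ≤ ‖|x| ⊔ |y|‖ :=
      induction₂ (p := fun x y => ‖|x|‖ ≤ ‖|x| ⊔ |y|‖)
        (isClosed_le (continuous_abs'.comp continuous_fst).norm
          ((continuous_abs'.comp continuous_fst).sup (continuous_abs'.comp continuous_snd)).norm)
        (fun x y => by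
          rw [← of_abs, ← of_abs, ← of_sup, LinearIsometry.norm_map, LinearIsometry.norm_map]
          refine norm_le_norm_of_abs_le_abs ?_
          rw [abs_abs, abs_of_nonneg ((abs_nonneg x).trans le_sup_left)]
          exact le_sup_left) x y
    rw [sup_eq_right.2 h] at h3
    rw [← h1, ← h2]
    exact h3

end BanachCompletion

end Completion
section Lift

variable {A : Type u}

theorem zero_mem_convexHull_of_forall (s : Finset (A →₀ ℝ))
    (h : ∀ ξ : A → ℝ, ∃ c ∈ s, 0 ≤ c.sum fun a r => r * ξ a) :
    (0 : A →₀ ℝ) ∈ convexHull ℝ (s : Set (A →₀ ℝ)) := by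
  classical
  by_contra h0
  let ι : (A →₀ ℝ) →ₗ[ℝ] (A → ℝ) := Finsupp.lcoeFun
  have himg : (0 : A → ℝ) ∉ convexHull ℝ (ι '' (s : Set (A →₀ ℝ))) := by
    rw [← LinearMap.image_convexHull]
    rintro ⟨c, hc, hc0⟩
    have : c = 0 := DFunLike.coe_injective hc0
    exact h0 (this ▸ hc)
  have hcomp : IsCompact (convexHull ℝ (ι '' (s : Set (A →₀ ℝ)))) :=
    (s.finite_toSet.image ι).isCompact_convexHull ℝ
  obtain ⟨φ, u, hu1, hu2⟩ := geometric_hahn_banach_closed_point (convex_convexHull ℝ _)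
    hcomp.isClosed himg
  rw [map_zero] at hu2
  obtain ⟨c, hc, hpos⟩ := h fun a => φ (ι (Finsupp.single a 1))
  have h1 := hu1 (ι c) (subset_convexHull ℝ _ ⟨c, hc, rfl⟩)
  have h2 : φ (ι c) = c.sum fun a r => r * φ (ι (Finsupp.single a 1)) := by
    conv_lhs => rw [← Finsupp.sum_single c]
    rw [Finsupp.sum, Finsupp.sum, map_sum, map_sum]
    refine Finset.sum_congr rfl fun a _ => ?_
    rw [← smul_eq_mul, ← map_smul, ← map_smul, Finsupp.smul_single, smul_eq_mul, mul_one]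
  rw [h2] at h1
  linarith

variable {E : Type v} [AddCommGroup E] [Module ℝ E] [Lattice E] [IsOrderedAddMonoid E]
  [IsOrderedModule ℝ E]

theorem smul_sup_of_nonneg {c : ℝ} (hc : 0 ≤ c) (x y : E) : c • (x ⊔ y) = c • x ⊔ c • y := by
  rcases hc.eq_or_lt with rfl | hc
  · rw [zero_smul, zero_smul, zero_smul, sup_idem]
  · exact (OrderIso.smulRight hc).map_sup x y

theorem smul_inf_of_nonneg {c : ℝ} (hc : 0 ≤ c) (x y : E) : c • (x ⊓ y) = c • x ⊓ c • y := by
  rcases hc.eq_or_lt with rfl | hc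
  · rw [zero_smul, zero_smul, zero_smul, inf_idem]
  · exact (OrderIso.smulRight hc).map_inf x y

/-- The lattice generated by a linear subspace is a linear subspace. -/
theorem vectorLatticeClosure_subset (W : Submodule ℝ E) :
    (vectorLatticeClosure (W : Set E) : Set E) ⊆ latticeClosure (W : Set E) := by
  have hL := isSublattice_latticeClosure (s := (W : Set E))
  have add₁ : ∀ w ∈ W, ∀ x ∈ latticeClosure (W : Set E), w + x ∈ latticeClosure (W : Set E) := by
    intro w hw x hx
    induction hx using latticeClosure_sup_inf_induction with
    | mem a ha => exact subset_latticeClosure (W.add_mem hw ha)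
    | sup a _ b _ ha hb => rw [add_sup]; exact hL.supClosed ha hb
    | inf a _ b _ ha hb => rw [add_inf]; exact hL.infClosed ha hb
  have add₂ : ∀ y ∈ latticeClosure (W : Set E), ∀ x ∈ latticeClosure (W : Set E),
      y + x ∈ latticeClosure (W : Set E) := by
    intro y hy x hx
    induction hy using latticeClosure_sup_inf_induction with
    | mem a ha => exact add₁ a ha x hx
    | sup a _ b _ ha hb => rw [sup_add]; exact hL.supClosed ha hb
    | inf a _ b _ ha hb => rw [inf_add]; exact hL.infClosed ha hb
  have neg : ∀ x ∈ latticeClosure (W : Set E), -x ∈ latticeClosure (W : Set E) := by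
    intro x hx
    induction hx using latticeClosure_sup_inf_induction with
    | mem a ha => exact subset_latticeClosure (W.neg_mem ha)
    | sup a _ b _ ha hb => rw [neg_sup]; exact hL.infClosed ha hb
    | inf a _ b _ ha hb => rw [neg_inf]; exact hL.supClosed ha hb
  have smul : ∀ c : ℝ, 0 ≤ c → ∀ x ∈ latticeClosure (W : Set E),
      c • x ∈ latticeClosure (W : Set E) := by
    intro c hc x hx
    induction hx using latticeClosure_sup_inf_induction with
    | mem a ha => exact subset_latticeClosure (W.smul_mem c ha)
    | sup a _ b _ ha hb => rw [smul_sup_of_nonneg hc]; exact hL.supClosed ha hb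
    | inf a _ b _ ha hb => rw [smul_inf_of_nonneg hc]; exact hL.infClosed ha hb
  let p : Submodule ℝ E :=
    { carrier := latticeClosure (W : Set E)
      zero_mem' := subset_latticeClosure W.zero_mem
      add_mem' := fun {x y} hx hy => add₂ x hx y hy
      smul_mem' := fun c x hx => by
        rcases le_total 0 c with hc | hc
        · exact smul c hc x hx
        · have := neg _ (smul (-c) (neg_nonneg.2 hc) x hx)
          rwa [neg_smul, neg_neg] at this }
  exact vectorLatticeClosure_le (p := p) subset_latticeClosure hL

/-- In the vector sublattice of `ℝ^(ℝ^A) × E` generated by the pairs `(δ_a, x_a)`, the second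
component is positive whenever the first one is. -/
theorem nonneg_of_mem_closure (x : A → E) {p : ((A → ℝ) → ℝ) × E}
    (hp : p ∈ vectorLatticeClosure (Set.range fun a => (coord A a, x a))) (h0 : 0 ≤ p.1) :
    0 ≤ p.2 := by
  classical
  let L : (A →₀ ℝ) →ₗ[ℝ] ((A → ℝ) → ℝ) × E :=
    Finsupp.linearCombination ℝ fun a => (coord A a, x a)
  have hL : ∀ (c : A →₀ ℝ) (ξ : A → ℝ), (L c).1 ξ = c.sum fun a r => r * ξ a := by
    intro c ξ
    simp only [L, Finsupp.linearCombination_apply, Finsupp.sum, Prod.fst_sum, Finset.sum_apply]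
    rfl
  have _ : IsOrderedModule ℝ (((A → ℝ) → ℝ) × E) :=
    { smul_le_smul_of_nonneg_left := fun c hc _ _ h =>
        ⟨fun ξ => mul_le_mul_of_nonneg_left (h.1 ξ) hc, smul_le_smul_of_nonneg_left h.2 hc⟩
      smul_le_smul_of_nonneg_right := fun _ hp _ _ h =>
        ⟨fun ξ => mul_le_mul_of_nonneg_right h (hp.1 ξ), smul_le_smul_of_nonneg_right h hp.2⟩ }
  have h1 : p ∈ latticeClosure (LinearMap.range L : Set (((A → ℝ) → ℝ) × E)) := by
    refine vectorLatticeClosure_subset _ ?_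
    refine vectorLatticeClosure_le ?_ (isSublattice_vectorLatticeClosure _) hp
    rintro _ ⟨a, rfl⟩
    refine subset_vectorLatticeClosure _ ⟨Finsupp.single a 1, ?_⟩
    simp [L]
  let _ : DistribLattice (((A → ℝ) → ℝ) × E) := AddCommGroup.toDistribLattice _
  have h2 : p ∈ infClosure (supClosure (LinearMap.range L : Set (((A → ℝ) → ℝ) × E))) := by
    rw [infClosure_supClosure]; exact h1
  obtain ⟨t, ht, hts, rfl⟩ := h2
  suffices h : (0 : ((A → ℝ) → ℝ) × E) ≤ t.inf' ht id from h.2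
  refine Finset.le_inf' _ _ fun q hq => ?_
  have hq0 : 0 ≤ q.1 := h0.trans (Finset.inf'_le id hq).1
  obtain ⟨s, hs, hsW, rfl⟩ := hts hq
  choose! g hg using fun y (hy : y ∈ s) => hsW hy
  have hmem : (0 : A →₀ ℝ) ∈ convexHull ℝ ((s.image g : Finset _) : Set (A →₀ ℝ)) := by
    refine zero_mem_convexHull_of_forall _ fun ξ => ?_
    by_contra! hneg
    have : ∀ y ∈ s, y.1 ξ < 0 := fun y hy => by
      have := hneg (g y) (Finset.mem_image_of_mem g hy)
      rwa [← hL, hg y hy] at this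
    have key : (s.sup' hs id).1 ξ < 0 := by
      have e : (s.sup' hs id).1 ξ = s.sup' hs (fun y => y.1 ξ) :=
        Finset.apply_sup'_eq_sup'_comp hs (fun y : ((A → ℝ) → ℝ) × E => y.1 ξ) (fun _ _ => rfl)
      rw [e, Finset.sup'_lt_iff]
      exact this
    exact absurd (hq0 ξ) (not_le.2 key)
  have hconv : Convex ℝ {c : A →₀ ℝ | L c ≤ s.sup' hs id} := by
    intro c hc d hd α β hα hβ hαβ
    change L (α • c + β • d) ≤ s.sup' hs id
    rw [map_add, map_smul, map_smul, ← one_smul ℝ (s.sup' hs id), ← hαβ, add_smul]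
    exact add_le_add (smul_le_smul_of_nonneg_left hc hα) (smul_le_smul_of_nonneg_left hd hβ)
  have := convexHull_min (s := ((s.image g : Finset _) : Set (A →₀ ℝ))) (fun c hc => by
    obtain ⟨y, hy, rfl⟩ := Finset.mem_image.1 hc
    change L (g y) ≤ s.sup' hs id
    rw [hg y hy]
    exact Finset.le_sup' id hy) hconv hmem
  simpa using this

/-- `FVL A` is the free vector lattice over `A`. -/
theorem FVL.existsUnique_lift (x : A → E) :
    ∃! T : FVL A →ₗ[ℝ] E, IsLatticeHom T ∧ ∀ a, T (FVL.gen a) = x a := by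
  let G := vectorLatticeClosure (Set.range fun a => (coord A a, x a))
  have hG := isSublattice_vectorLatticeClosure (Set.range fun a => (coord A a, x a))
  have hex : ∀ f : FVL A, ∃ e : E, (f.eval, e) ∈ G := by
    intro f
    induction f using FVL.induction with
    | gen a => exact ⟨x a, subset_vectorLatticeClosure _ ⟨a, rfl⟩⟩
    | zero => exact ⟨0, G.zero_mem⟩
    | add f g hf hg => exact ⟨_, G.add_mem hf.choose_spec hg.choose_spec⟩
    | smul c f hf => exact ⟨_, G.smul_mem c hf.choose_spec⟩
    | sup f g hf hg => exact ⟨_, hG.supClosed hf.choose_spec hg.choose_spec⟩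
    | inf f g hf hg => exact ⟨_, hG.infClosed hf.choose_spec hg.choose_spec⟩
  have huniq : ∀ (f : (A → ℝ) → ℝ) (e e' : E), (f, e) ∈ G → (f, e') ∈ G → e = e' := by
    intro f e e' h h'
    have h1 := G.sub_mem h h'
    have h2 := G.sub_mem h' h
    have h3 := nonneg_of_mem_closure x h1 (by simp)
    have h4 := nonneg_of_mem_closure x h2 (by simp)
    exact le_antisymm (sub_nonneg.1 h4) (sub_nonneg.1 h3)
  choose T hT using hex
  refine ⟨{ toFun := T, map_add' := fun f g => ?_, map_smul' := fun c f => ?_ },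
    ⟨⟨fun f g => ?_, fun f g => ?_⟩, fun a => ?_⟩, ?_⟩
  · exact huniq _ _ _ (hT (f + g)) (G.add_mem (hT f) (hT g))
  · exact huniq _ _ _ (hT (c • f)) (G.smul_mem c (hT f))
  · exact huniq _ _ _ (hT (f ⊔ g)) (hG.supClosed (hT f) (hT g))
  · exact huniq _ _ _ (hT (f ⊓ g)) (hG.infClosed (hT f) (hT g))
  · exact huniq _ _ _ (hT (FVL.gen a)) (subset_vectorLatticeClosure _ ⟨a, rfl⟩)
  · rintro S ⟨hS, hSx⟩
    refine LinearMap.ext fun f => huniq f.eval _ _ ?_ (hT f)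
    induction f using FVL.induction with
    | gen a => rw [hSx]; exact subset_vectorLatticeClosure _ ⟨a, rfl⟩
    | zero => rw [map_zero]; exact G.zero_mem
    | add f g hf hg => rw [map_add]; exact G.add_mem hf hg
    | smul c f hf => rw [map_smul]; exact G.smul_mem c hf
    | sup f g hf hg => rw [hS.map_sup]; exact hG.supClosed hf hg
    | inf f g hf hg => rw [hS.map_inf]; exact hG.infClosed hf hg

end Lift

section Free

/-- In a normed vector lattice, each element has a positive norming functional. -/
theorem exists_positive_functional {Y : Type v} [NormedAddCommGroup Y] [NormedSpace ℝ Y]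
    [Lattice Y] [IsOrderedAddMonoid Y] [IsOrderedModule ℝ Y] [HasSolidNorm Y] (y : Y) (hy : 0 ≤ y) :
    ∃ ψ : Y →ₗ[ℝ] ℝ, (∀ z, 0 ≤ z → 0 ≤ ψ z) ∧ (∀ z, ψ z ≤ ‖z‖) ∧ ψ y = ‖y‖ := by
  have hpos : ∀ z : Y, ‖z ⊔ 0‖ ≤ ‖z‖ := fun z => by
    refine norm_le_norm_of_abs_le_abs ?_
    rw [abs_of_nonneg (le_sup_right : 0 ≤ z ⊔ 0)]
    exact sup_le (le_abs_self z) (abs_nonneg z)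
  have hN : ∀ c : ℝ, 0 < c → ∀ z : Y, ‖(c • z) ⊔ 0‖ = c * ‖z ⊔ 0‖ := fun c hc z => by
    have : (c • z) ⊔ 0 = c • (z ⊔ 0) := by rw [smul_sup_of_nonneg hc.le, smul_zero]
    rw [this, norm_smul, Real.norm_eq_abs, abs_of_pos hc]
  by_cases hy0 : y = 0
  · exact ⟨0, fun _ _ => le_rfl, fun z => by simp, by simp [hy0]⟩
  let f : Y →ₗ.[ℝ] ℝ := LinearPMap.mkSpanSingleton y ‖y‖ hy0
  obtain ⟨ψ, h1, h2⟩ := exists_extension_of_le_sublinear f (fun z => ‖z ⊔ 0‖) hN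
    (fun a b => by
      refine (norm_le_norm_of_abs_le_abs ?_).trans (norm_add_le (a ⊔ 0) (b ⊔ 0))
      rw [abs_of_nonneg le_sup_right, abs_of_nonneg (add_nonneg le_sup_right le_sup_right)]
      exact sup_le (add_le_add le_sup_left le_sup_left) (add_nonneg le_sup_right le_sup_right))
    (by
      rintro ⟨z, hz⟩
      obtain ⟨c, rfl⟩ := Submodule.mem_span_singleton.1 hz
      have e : f ⟨c • y, hz⟩ = c * ‖y‖ := by
        exact LinearPMap.mkSpanSingleton'_apply _ _ _ _ _
      rw [e]
      rcases le_or_gt c 0 with hc | hc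
      · exact (mul_nonpos_of_nonpos_of_nonneg hc (norm_nonneg y)).trans (norm_nonneg _)
      · change c * ‖y‖ ≤ ‖(c • y) ⊔ 0‖
        rw [hN c hc, sup_eq_left.2 hy])
  refine ⟨ψ, fun z hz => ?_, fun z => (h2 z).trans (hpos z), ?_⟩
  · have := h2 (-z)
    rw [map_neg, sup_eq_right.2 (neg_nonpos.2 hz), norm_zero] at this
    linarith
  · have hmem : y ∈ f.domain := Submodule.mem_span_singleton_self y
    have := h1 ⟨y, hmem⟩
    rw [this]
    exact LinearPMap.mkSpanSingleton_apply ℝ ℝ hy0 _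

variable (A : Type u)

/-- The free Banach lattice `FBL(A)` over `A`: the completion of `(FVL(A), ‖·‖_F)`. -/
abbrev FBL : Type u := BanachCompletion (FVL A)

variable {A}

/-- The free generators `δ_a` of `FBL(A)`. -/
def FBL.gen (a : A) : FBL A := BanachCompletion.of (FVL.gen a)

/-- The continuous linear extension to the completion of a bounded linear map. -/
def BanachCompletion.lift {E : Type u} [NormedAddCommGroup E] [NormedSpace ℝ E]
    {Y : Type v} [NormedAddCommGroup Y] [NormedSpace ℝ Y] [CompleteSpace Y] (T : E →L[ℝ] Y) :
    BanachCompletion E →L[ℝ] Y :=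
  (T.fromCompletion : UniformSpace.Completion E →L[ℝ] Y)

theorem BanachCompletion.lift_of {E : Type u} [NormedAddCommGroup E] [NormedSpace ℝ E]
    {Y : Type v} [NormedAddCommGroup Y] [NormedSpace ℝ Y] [CompleteSpace Y] (T : E →L[ℝ] Y)
    (x : E) : BanachCompletion.lift T (BanachCompletion.of x) = T x :=
  ContinuousLinearMap.fromCompletion_apply_coe T x

theorem FVL.norm_gen_le (a : A) : ‖(FVL.gen a : FVL A)‖ ≤ 1 :=
  FVL.normF_le fun _ hφ => hφ.2 a

/-- `FBL(A)`, with its generators, has the universal property that defines the free Banach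
lattice over `A`: every bounded map `κ` from `A` to a Banach lattice `Y` extends uniquely to a
lattice homomorphism on `FBL(A)` of norm `sup_a ‖κ a‖`. -/
theorem FBL.existsUnique_lift {Y : Type v} [NormedAddCommGroup Y] [NormedSpace ℝ Y]
    [CompleteSpace Y] [Lattice Y] [IsOrderedAddMonoid Y] [IsOrderedModule ℝ Y] [HasSolidNorm Y]
    (κ : A → Y) (hκ : BddAbove (Set.range fun a => ‖κ a‖)) :
    ∃! T : FBL A →L[ℝ] Y, IsLatticeHom (T : FBL A →ₗ[ℝ] Y) ∧ (∀ a, T (FBL.gen a) = κ a) ∧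
      ‖T‖ = ⨆ a, ‖κ a‖ := by
  obtain ⟨T₀, ⟨hT₀, hgen⟩, -⟩ := FVL.existsUnique_lift κ
  let M : ℝ := ⨆ a, ‖κ a‖
  have hM : ∀ a, ‖κ a‖ ≤ M := fun a => le_ciSup hκ a
  have hM0 : 0 ≤ M := Real.iSup_nonneg fun a => norm_nonneg _
  have habs : ∀ f, T₀ |f| = |T₀ f| := fun f => by
    change T₀ (f ⊔ -f) = T₀ f ⊔ - T₀ f
    rw [hT₀.map_sup, map_neg]
  have hbound : ∀ f, ‖T₀ f‖ ≤ M * ‖f‖ := by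
    intro f
    obtain ⟨ψ, hψ0, hψ1, hψ⟩ := exists_positive_functional |T₀ f| (abs_nonneg _)
    rw [norm_abs_eq_norm, ← habs] at hψ
    have hpos : ∀ g, 0 ≤ g → 0 ≤ ψ (T₀ g) := fun g hg => hψ0 _ (by
      have := habs g
      rw [abs_of_nonneg hg] at this
      rw [this]
      exact abs_nonneg _)
    have hle : ∀ a, ψ (T₀ |FVL.gen a|) ≤ M := fun a => by
      rw [habs, hgen]
      exact (hψ1 _).trans (by rw [norm_abs_eq_norm]; exact hM a)
    rw [← hψ]
    rcases hM0.eq_or_lt with h | h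
    · obtain ⟨B, C, hC, hB⟩ := FVL.exists_finset f
      rw [← h, zero_mul]
      have h1 := hpos _ (sub_nonneg.2 hB)
      rw [map_sub, map_sub, map_smul, map_smul, map_sum, map_sum, smul_eq_mul] at h1
      have h2 : ∑ b ∈ B, ψ (T₀ |FVL.gen b|) ≤ 0 :=
        Finset.sum_nonpos fun b _ => (hle b).trans h.symm.le
      have h3 := mul_nonpos_of_nonneg_of_nonpos hC h2
      linarith
    · have hmem : M⁻¹ • (ψ.comp T₀) ∈ FVL.dualBall A :=
        ⟨fun g hg => mul_nonneg (inv_nonneg.2 hM0) (hpos g hg), fun a => by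
          change M⁻¹ * ψ (T₀ |FVL.gen a|) ≤ 1
          rw [inv_mul_le_iff₀ h, mul_one]
          exact hle a⟩
      have := FVL.le_normF hmem f
      change M⁻¹ * ψ (T₀ |f|) ≤ ‖f‖ at this
      rwa [inv_mul_le_iff₀ h] at this
  let T := BanachCompletion.lift (T₀.mkContinuous M hbound)
  have hT : ∀ f, T (BanachCompletion.of f) = T₀ f := fun f => BanachCompletion.lift_of _ f
  refine ⟨T, ⟨⟨?_, ?_⟩, ?_, ?_⟩, ?_⟩
  · refine BanachCompletion.induction₂ (isClosed_eq ?_ ?_) fun f g => ?_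
    · exact T.continuous.comp continuous_sup
    · exact (T.continuous.comp continuous_fst).sup (T.continuous.comp continuous_snd)
    · change T _ = T _ ⊔ T _
      rw [← BanachCompletion.of_sup, hT, hT, hT, hT₀.map_sup]
  · refine BanachCompletion.induction₂ (isClosed_eq ?_ ?_) fun f g => ?_
    · exact T.continuous.comp continuous_inf
    · exact (T.continuous.comp continuous_fst).inf (T.continuous.comp continuous_snd)
    · change T _ = T _ ⊓ T _
      rw [← BanachCompletion.of_inf, hT, hT, hT, hT₀.map_inf]
  · exact fun a => (hT _).trans (hgen a)
  · refine le_antisymm ?_ ?_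
    · refine ContinuousLinearMap.opNorm_le_bound _ hM0 ?_
      refine BanachCompletion.induction₁ (isClosed_le ?_ ?_) fun f => ?_
      · exact T.continuous.norm
      · exact continuous_const.mul continuous_norm
      · rw [hT, LinearIsometry.norm_map]
        exact hbound f
    · refine Real.iSup_le (fun a => ?_) (norm_nonneg _)
      rw [← hgen a, ← hT]
      refine (T.le_opNorm _).trans ?_
      rw [LinearIsometry.norm_map]
      exact mul_le_of_le_one_right (norm_nonneg _) (FVL.norm_gen_le a)
  · rintro S ⟨hS, hSg, -⟩
    refine ContinuousLinearMap.ext fun x => ?_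
    refine BanachCompletion.induction₁ (isClosed_eq S.continuous T.continuous) (fun f => ?_) x
    induction f using FVL.induction with
    | gen a => rw [hT, hgen]; exact hSg a
    | zero => rw [map_zero, map_zero, map_zero]
    | add f g hf hg => rw [map_add, map_add, map_add, hf, hg]
    | smul c f hf => rw [map_smul, map_smul, map_smul, hf]
    | sup f g hf hg =>
      have := hS.map_sup (BanachCompletion.of f) (BanachCompletion.of g)
      change S _ = S _ ⊔ S _ at this
      rw [hT, hT₀.map_sup, ← hT, ← hT, BanachCompletion.of_sup, this, hf, hg]
    | inf f g hf hg =>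
      have := hS.map_inf (BanachCompletion.of f) (BanachCompletion.of g)
      change S _ = S _ ⊓ S _ at this
      rw [hT, hT₀.map_inf, ← hT, ← hT, BanachCompletion.of_inf, this, hf, hg]

end Free
section Representation

variable (A : Type u)

/-- The cube `Δ_A = [-1, 1]^A`, a compact subset of `ℝ^A` with the product topology. -/
def Cube : Set (A → ℝ) := Set.univ.pi fun _ => Set.Icc (-1) 1

instance : CompactSpace (Cube A) :=
  isCompact_iff_compactSpace.1 (isCompact_univ_pi fun _ => isCompact_Icc)

/-- The continuous real functions `f` on `Δ_A` that are positively homogeneous, that is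
`f (t ξ) = t f ξ` for `ξ ∈ Δ_A` and `t ∈ [0, 1]`. -/
def homogeneous : Submodule ℝ C(Cube A, ℝ) where
  carrier := {f | ∀ t : ℝ, 0 ≤ t → t ≤ 1 → ∀ ξ η : Cube A, (η : A → ℝ) = t • (ξ : A → ℝ) →
    f η = t * f ξ}
  zero_mem' := fun t _ _ _ _ _ => by simp
  add_mem' := fun {f g} hf hg t h0 h1 ξ η h => by
    rw [ContinuousMap.add_apply, ContinuousMap.add_apply, hf t h0 h1 ξ η h, hg t h0 h1 ξ η h,
      mul_add]
  smul_mem' := fun c f hf t h0 h1 ξ η h => by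
    rw [ContinuousMap.smul_apply, ContinuousMap.smul_apply, hf t h0 h1 ξ η h, smul_eq_mul,
      smul_eq_mul, mul_left_comm]

/-- The Banach lattice `H(Δ_A)` of continuous positively homogeneous real functions on `Δ_A`, with
the pointwise operations and order and the supremum norm of `C(Δ_A)`. -/
def H : Type u := homogeneous A

namespace H

instance : NormedAddCommGroup (H A) := inferInstanceAs (NormedAddCommGroup (homogeneous A))

instance : NormedSpace ℝ (H A) := inferInstanceAs (NormedSpace ℝ (homogeneous A))

instance : Lattice (H A) :=
  Subtype.lattice (P := fun f => f ∈ homogeneous A)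
    (fun f g hf hg t h0 h1 ξ η h => by
      rw [ContinuousMap.sup_apply, ContinuousMap.sup_apply, hf t h0 h1 ξ η h, hg t h0 h1 ξ η h,
        mul_max_of_nonneg _ _ h0])
    (fun f g hf hg t h0 h1 ξ η h => by
      rw [ContinuousMap.inf_apply, ContinuousMap.inf_apply, hf t h0 h1 ξ η h, hg t h0 h1 ξ η h,
        mul_min_of_nonneg _ _ h0])

instance : CompleteSpace (H A) := by
  refine IsClosed.completeSpace_coe (s := (homogeneous A : Set C(Cube A, ℝ))) (hs := ?_)
  have : (homogeneous A : Set C(Cube A, ℝ)) = ⋂ (t : ℝ) (_ : 0 ≤ t) (_ : t ≤ 1) (ξ : Cube A)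
      (η : Cube A) (_ : (η : A → ℝ) = t • (ξ : A → ℝ)), {f : C(Cube A, ℝ) | f η = t * f ξ} := by
    ext f
    simp only [mem_iInter]
    rfl
  rw [this]
  repeat refine isClosed_iInter fun _ => ?_
  exact isClosed_eq (continuous_eval_const _) (continuous_const.mul (continuous_eval_const _))

variable {A}

/-- The continuous function on `Δ_A` underlying an element of `H(Δ_A)`. -/
def toFun (f : H A) : C(Cube A, ℝ) := f.1

/-- Elements of `H(Δ_A)` are applied to points of `Δ_A` as functions. -/
instance : CoeFun (H A) (fun _ => Cube A → ℝ) := ⟨fun f => f.toFun⟩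

theorem ext {f g : H A} (h : ∀ ξ, f ξ = g ξ) : f = g := Subtype.ext (ContinuousMap.ext h)
theorem norm_def (f : H A) : ‖f‖ = ‖f.toFun‖ := rfl
theorem le_iff {f g : H A} : f ≤ g ↔ ∀ ξ, f ξ ≤ g ξ := Iff.rfl
theorem add_apply (f g : H A) (ξ : Cube A) : (f + g) ξ = f ξ + g ξ := rfl
theorem neg_apply (f : H A) (ξ : Cube A) : (-f) ξ = -f ξ := rfl
theorem smul_apply (c : ℝ) (f : H A) (ξ : Cube A) : (c • f) ξ = c * f ξ := rfl
theorem sup_apply (f g : H A) (ξ : Cube A) : (f ⊔ g) ξ = f ξ ⊔ g ξ := rfl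
theorem inf_apply (f g : H A) (ξ : Cube A) : (f ⊓ g) ξ = f ξ ⊓ g ξ := rfl

instance : IsOrderedAddMonoid (H A) where
  add_le_add_left _ _ h k := fun ξ => add_le_add_left (h ξ) (k ξ)

instance : IsOrderedModule ℝ (H A) where
  smul_le_smul_of_nonneg_left _ hc _ _ h := fun ξ => mul_le_mul_of_nonneg_left (h ξ) hc
  smul_le_smul_of_nonneg_right _ hf _ _ h := fun ξ => mul_le_mul_of_nonneg_right h (hf ξ)

instance : HasSolidNorm (H A) where
  solid f g h := (ContinuousMap.norm_le f.toFun (norm_nonneg g.toFun)).2 fun ξ =>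
    (h ξ : |f ξ| ≤ |g ξ|).trans (ContinuousMap.norm_coe_le_norm g.toFun ξ)

end H

variable {A}

/-- The restriction map `FVL(A) → H(Δ_A)`. -/
def restrict : FVL A →ₗ[ℝ] H A where
  toFun f := ⟨⟨fun ξ => f.eval ξ, f.continuous_eval.comp continuous_subtype_val⟩,
    fun t h0 _ ξ η h => by
      change f.eval η = t * f.eval ξ
      rw [h, f.eval_pos_smul t h0]⟩
  map_add' _ _ := rfl
  map_smul' _ _ := rfl

theorem norm_restrict_le (f : FVL A) : ‖restrict f‖ ≤ 1 * ‖f‖ := by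
  rw [one_mul, H.norm_def]
  refine (ContinuousMap.norm_le _ (norm_nonneg f)).2 fun ξ => ?_
  exact FVL.abs_eval_le_normF f fun a => abs_le.2 (ξ.2 a (Set.mem_univ a))

variable (A) in
/-- The canonical map `J : FBL(A) → H(Δ_A)`: the extension by continuity of the restriction map
from `FVL(A)` to its completion `FBL(A)`. -/
def J : FBL A →L[ℝ] H A :=
  BanachCompletion.lift (restrict.mkContinuous 1 norm_restrict_le)

theorem J_of (f : FVL A) : J A (BanachCompletion.of f) = restrict f :=
  BanachCompletion.lift_of _ f

theorem J_gen (a : A) (ξ : Cube A) : J A (FBL.gen a) ξ = (ξ : A → ℝ) a := by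
  rw [FBL.gen, J_of]
  rfl

end Representation

end FreeBanachLattice

end

noncomputable section

namespace FreeBanachLattice

open Set Topology

/-! The argument rests on the band-like maps `P_B f (ξ) = f (1_B ξ)` for `B ⊆ A`, which switch off
the coordinates outside `B`. Each `P_B` is a lattice homomorphism on `FVL A` with `P_B |δ_a| ≤
|δ_a|`, so composing with it preserves the dual ball defining `‖·‖_F`; hence `P_B` is contractive
and extends to `FBL A`. For finite `B`, positive homogeneity gives `|P_B f| ≤ ‖Jf‖ ∑_{b ∈ B} |δ_b|`
pointwise, whence `‖P_B f‖ ≤ card B * ‖Jf‖` (`FBL.norm_proj_le_card_mul`), an estimate that survives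
completion.

Injectivity of `J` follows: if `Jx = 0` then `P_B x = 0` for every finite `B`, while `x` is a limit
of elements of `FVL A`, each fixed by some such `P_B`. As `J` is also a lattice homomorphism, it
reflects the order.

A real lattice homomorphism `ω` is positive, hence bounded, by completeness. On `FVL A` it must be
evaluation at `η = (ω δ_a)_a`, because the `δ_a` generate; boundedness lets `η` be rescaled into the
cube, and density carries the formula to `FBL A`. Since evaluations at points of the cube are
lattice homomorphisms, injectivity of `J` yields separation of points.

For finite `A`, taking `B = A` makes `P_B` the identity, so `J` is bounded below and has closed
range. The range is dense by the lattice form of Stone–Weierstrass on the unit sphere of the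
supremum norm, and homogeneity spreads the approximation over the cube. -/

theorem IsLatticeHom.map_abs {E F : Type*} [AddCommGroup E] [Module ℝ E] [Lattice E]
    [AddCommGroup F] [Module ℝ F] [Lattice F] {T : E →ₗ[ℝ] F} (hT : IsLatticeHom T) (x : E) :
    T |x| = |T x| := by
  change T (x ⊔ -x) = T x ⊔ -T x
  rw [hT.map_sup, map_neg]

/-- A positive linear functional on a Banach lattice is bounded. -/
theorem exists_bound_of_nonneg {Y : Type*} [NormedAddCommGroup Y] [NormedSpace ℝ Y]
    [CompleteSpace Y] [Lattice Y] [IsOrderedAddMonoid Y] [IsOrderedModule ℝ Y] [HasSolidNorm Y]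
    (φ : Y →ₗ[ℝ] ℝ) (hφ : ∀ y, 0 ≤ y → 0 ≤ φ y) : ∃ C, ∀ y, ‖φ y‖ ≤ C * ‖y‖ := by
  have hmono : ∀ x y, x ≤ y → φ x ≤ φ y := fun x y h => by
    have := hφ (y - x) (sub_nonneg.2 h)
    rw [map_sub] at this
    linarith
  have habs : ∀ y, ‖φ y‖ ≤ φ |y| := fun y => by
    refine abs_le.2 ⟨?_, hmono _ _ (le_abs_self y)⟩
    have := hmono _ _ (neg_le_abs y)
    rw [map_neg] at this
    linarith
  by_contra! hcon
  -- Failure of every bound `4 ^ n` is played against the weights `2 ^ (-n)`: the vectors `z n`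
  -- below are summable, yet `φ (z n)` is still at least `2 ^ n`.
  choose y hy using fun n : ℕ => hcon (4 ^ n)
  have hy0 : ∀ n, 0 < ‖y n‖ := fun n => norm_pos_iff.2 fun h => by
    have := hy n
    simp [h] at this
  let z : ℕ → Y := fun n => ((1 / 2 : ℝ) ^ n * ‖y n‖⁻¹) • |y n|
  have hz0 : ∀ n, 0 ≤ z n := fun n => smul_nonneg (by positivity) (abs_nonneg _)
  have hznorm : ∀ n, ‖z n‖ = (1 / 2 : ℝ) ^ n := fun n => by
    rw [norm_smul, norm_abs_eq_norm, Real.norm_of_nonneg (by positivity), mul_assoc,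
      inv_mul_cancel₀ (hy0 n).ne', mul_one]
  have hsum : Summable z := Summable.of_norm (by
    simp only [hznorm]
    exact summable_geometric_two)
  -- The sum dominates each of its positive terms, so the single number `φ (∑' n, z n)` would exceed
  -- every `2 ^ n`.
  have hbig : ∀ n, (2 : ℝ) ^ n ≤ φ (∑' n, z n) := fun n => by
    refine le_trans ?_ (hmono _ _ (hsum.le_tsum n fun j _ => hz0 j))
    have h1 : (4 : ℝ) ^ n * ‖y n‖ ≤ φ |y n| := (hy n).le.trans (habs _)
    calc (2 : ℝ) ^ n = (1 / 2 : ℝ) ^ n * ‖y n‖⁻¹ * (4 ^ n * ‖y n‖) := by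
          rw [show (4 : ℝ) ^ n = 2 ^ n * 2 ^ n by rw [← mul_pow]; norm_num, one_div, inv_pow]
          have := (hy0 n).ne'
          field_simp
      _ ≤ (1 / 2 : ℝ) ^ n * ‖y n‖⁻¹ * φ |y n| := mul_le_mul_of_nonneg_left h1 (by positivity)
      _ = φ (z n) := by rw [map_smul, smul_eq_mul]
  obtain ⟨n, hn⟩ := pow_unbounded_of_one_lt (φ (∑' n, z n)) (one_lt_two : (1 : ℝ) < 2)
  exact absurd (hbig n) (not_le.2 hn)

/-! ### Coordinate projections and injectivity of `J` -/

section Projection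

variable {A : Type u}

/-- Restricting points of `ℝ^A` to a set of coordinates induces an endomorphism of `FVL A`. -/
theorem FVL.exists_eval_indicator (B : Set A) (f : FVL A) :
    ∃ g : FVL A, ∀ ξ, g.eval ξ = f.eval (B.indicator ξ) := by
  classical
  induction f using FVL.induction with
  | gen a =>
    by_cases h : a ∈ B
    · exact ⟨FVL.gen a, fun ξ => by simp [h]⟩
    · exact ⟨0, fun ξ => by simp [h]⟩
  | zero => exact ⟨0, fun ξ => rfl⟩
  | add f g hf hg =>
    obtain ⟨f', hf⟩ := hf
    obtain ⟨g', hg⟩ := hg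
    exact ⟨f' + g', fun ξ => by simp [hf, hg]⟩
  | smul c f hf =>
    obtain ⟨f', hf⟩ := hf
    exact ⟨c • f', fun ξ => by simp [hf]⟩
  | sup f g hf hg =>
    obtain ⟨f', hf⟩ := hf
    obtain ⟨g', hg⟩ := hg
    exact ⟨f' ⊔ g', fun ξ => by simp [hf, hg]⟩
  | inf f g hf hg =>
    obtain ⟨f', hf⟩ := hf
    obtain ⟨g', hg⟩ := hg
    exact ⟨f' ⊓ g', fun ξ => by simp [hf, hg]⟩

/-- The projection of `FVL A` onto the sublattice generated by the `δ_b`, `b ∈ B`. -/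
def FVL.proj (B : Set A) : FVL A →ₗ[ℝ] FVL A where
  toFun f := (f.exists_eval_indicator B).choose
  map_add' f g := FVL.ext fun ξ => by
    rw [FVL.eval_add, ((f + g).exists_eval_indicator B).choose_spec,
      (f.exists_eval_indicator B).choose_spec, (g.exists_eval_indicator B).choose_spec,
      FVL.eval_add]
  map_smul' c f := FVL.ext fun ξ => by
    rw [RingHom.id_apply, FVL.eval_smul, ((c • f).exists_eval_indicator B).choose_spec,
      (f.exists_eval_indicator B).choose_spec, FVL.eval_smul]

theorem FVL.eval_proj (B : Set A) (f : FVL A) (ξ : A → ℝ) :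
    (FVL.proj B f).eval ξ = f.eval (B.indicator ξ) :=
  (f.exists_eval_indicator B).choose_spec ξ

/-- Composition with the projection maps the dual ball into itself: positivity is kept, and the
image of `|δ_a|` is either `|δ_a|` or `0`. Since the projection commutes with the modulus, each `φ`
in the supremum for the left side is matched by one in the supremum for the right. -/
theorem FVL.norm_proj_le (B : Set A) (f : FVL A) : ‖FVL.proj B f‖ ≤ 1 * ‖f‖ := by
  rw [one_mul]
  refine FVL.normF_le fun φ hφ => ?_
  have hmem : φ.comp (FVL.proj B) ∈ FVL.dualBall A := by
    refine ⟨fun g hg => hφ.1 _ fun ξ => ?_, fun a => ?_⟩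
    · change 0 ≤ (FVL.proj B g).eval ξ
      rw [FVL.eval_proj]
      exact hg _
    · refine (FVL.mono_of_mem hφ fun ξ => ?_).trans (hφ.2 a)
      change (FVL.proj B |FVL.gen a|).eval ξ ≤ |FVL.gen a|.eval ξ
      rw [FVL.eval_proj, FVL.eval_abs, FVL.eval_abs, FVL.eval_gen, FVL.eval_gen]
      exact norm_indicator_le_norm_self ξ a
  have h : |FVL.proj B f| = FVL.proj B |f| := FVL.ext fun ξ => by
    rw [FVL.eval_abs, FVL.eval_proj, FVL.eval_proj, FVL.eval_abs]
  rw [h]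
  exact FVL.le_normF hmem f

/-- A positively homogeneous function is bounded on the points with finite support by its norm
on the cube. -/
theorem FVL.abs_eval_indicator_le (B : Finset A) (f : FVL A) (ξ : A → ℝ) :
    |f.eval ((B : Set A).indicator ξ)| ≤ ‖restrict f‖ * ∑ b ∈ B, |ξ b| := by
  classical
  set s := ∑ b ∈ B, |ξ b| with hs
  have hs0 : 0 ≤ s := Finset.sum_nonneg fun _ _ => abs_nonneg _
  have hle : ∀ a, |(B : Set A).indicator ξ a| ≤ s := fun a => by
    by_cases ha : a ∈ B
    · rw [Set.indicator_of_mem (Finset.mem_coe.2 ha)]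
      exact Finset.single_le_sum (f := fun b => |ξ b|) (fun _ _ => abs_nonneg _) ha
    · rw [Set.indicator_of_notMem (by simpa using ha), abs_zero]
      exact hs0
  -- If `s = 0` the convention `0⁻¹ = 0` makes this the origin, which still lies in the cube; `hη`
  -- then holds because the indicator vanishes.
  let η : Cube A := ⟨s⁻¹ • (B : Set A).indicator ξ, fun a _ => abs_le.1 (by
    rw [Pi.smul_apply, smul_eq_mul, abs_mul, abs_of_nonneg (inv_nonneg.2 hs0)]
    exact inv_mul_le_one_of_le₀ (hle a) hs0)⟩
  have hη : (B : Set A).indicator ξ = s • (η : A → ℝ) := by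
    rcases hs0.eq_or_lt with h | h
    · rw [← h, zero_smul]
      refine funext fun a => abs_nonpos_iff.1 ((hle a).trans h.symm.le)
    · exact (smul_inv_smul₀ h.ne' _).symm
  rw [hη, FVL.eval_pos_smul f s hs0, abs_mul, abs_of_nonneg hs0, mul_comm]
  exact mul_le_mul_of_nonneg_right (ContinuousMap.norm_coe_le_norm (restrict f).toFun η) hs0

/-- The pointwise bound by `‖restrict f‖ ∑_{b ∈ B} |ξ b|` is an inequality inside `FVL A`, so every
`φ` in the dual ball may be applied to it. Each of the terms `φ |δ_b|` is at most `1`, which is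
where `B.card` comes from. -/
theorem FVL.norm_proj_le_card_mul (B : Finset A) (f : FVL A) :
    ‖FVL.proj (B : Set A) f‖ ≤ B.card * ‖restrict f‖ := by
  refine FVL.normF_le fun φ hφ => ?_
  have h : |FVL.proj (B : Set A) f| ≤ ‖restrict f‖ • ∑ b ∈ B, |FVL.gen b| := fun ξ => by
    have hsum : (∑ b ∈ B, |FVL.gen b|).eval ξ = ∑ b ∈ B, |ξ b| :=
      map_sum (FVL.evalAt ξ) (fun b => |FVL.gen b|) B
    change |FVL.proj (B : Set A) f|.eval ξ ≤ (‖restrict f‖ • ∑ b ∈ B, |FVL.gen b|).eval ξ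
    rw [FVL.eval_abs, FVL.eval_proj, FVL.eval_smul, hsum]
    exact FVL.abs_eval_indicator_le B f ξ
  refine (FVL.mono_of_mem hφ h).trans ?_
  rw [map_smul, map_sum, smul_eq_mul, mul_comm]
  refine mul_le_mul_of_nonneg_right ?_ (norm_nonneg _)
  simpa using Finset.sum_le_card_nsmul B (fun b => φ |FVL.gen b|) 1 fun b _ => hφ.2 b

/-- An element of `FVL A` involves only finitely many coordinates, so the estimates for finite `B`
reach a dense part of `FBL A`. -/
theorem FVL.exists_proj_eq (f : FVL A) : ∃ B : Finset A, FVL.proj (B : Set A) f = f := by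
  obtain ⟨B, hB⟩ := f.exists_eval_eq
  refine ⟨B, FVL.ext fun ξ => ?_⟩
  rw [FVL.eval_proj]
  exact hB _ _ fun b hb => Set.indicator_of_mem (Finset.mem_coe.2 hb) ξ

/-- The projection of `FBL A` onto the part generated by the `δ_b`, `b ∈ B`. -/
def FBL.proj (B : Set A) : FBL A →L[ℝ] FBL A :=
  BanachCompletion.lift (BanachCompletion.of.toContinuousLinearMap.comp
    ((FVL.proj B).mkContinuous 1 (FVL.norm_proj_le B)))

theorem FBL.proj_of (B : Set A) (f : FVL A) :
    FBL.proj B (BanachCompletion.of f) = BanachCompletion.of (FVL.proj B f) :=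
  BanachCompletion.lift_of _ f

theorem FBL.norm_proj_le (B : Set A) (x : FBL A) : ‖FBL.proj B x‖ ≤ ‖x‖ := by
  refine BanachCompletion.induction₁ (p := fun x => ‖FBL.proj B x‖ ≤ ‖x‖)
    (isClosed_le (FBL.proj B).continuous.norm continuous_norm) (fun f => ?_) x
  rw [FBL.proj_of, LinearIsometry.norm_map, LinearIsometry.norm_map, ← one_mul ‖f‖]
  exact FVL.norm_proj_le B f

theorem FBL.norm_proj_le_card_mul (B : Finset A) (x : FBL A) :
    ‖FBL.proj (B : Set A) x‖ ≤ B.card * ‖J A x‖ := by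
  refine BanachCompletion.induction₁ (p := fun x => ‖FBL.proj (B : Set A) x‖ ≤ B.card * ‖J A x‖)
    (isClosed_le (FBL.proj _).continuous.norm
      (continuous_const.mul (J A).continuous.norm)) (fun f => ?_) x
  rw [FBL.proj_of, LinearIsometry.norm_map, J_of]
  exact FVL.norm_proj_le_card_mul B f

/-- The factor `B.card` is not bounded when `A` is infinite, so no uniform lower bound on `J` is
available here. It is not needed: on the kernel of `J` the estimate gives `0` for each finite `B`,
and contractivity of the projections does the rest. -/
theorem J_injective : Function.Injective (J A) := by
  refine (injective_iff_map_eq_zero (J A)).2 fun x hx => ?_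
  refine norm_le_zero_iff.1 (le_of_forall_pos_le_add fun ε hε => ?_)
  obtain ⟨f, hf⟩ := BanachCompletion.denseRange_of.exists_dist_lt x (half_pos hε)
  obtain ⟨B, hB⟩ := f.exists_proj_eq
  have h0 : FBL.proj (B : Set A) x = 0 := by
    have := FBL.norm_proj_le_card_mul B x
    rw [hx, norm_zero, mul_zero] at this
    exact norm_le_zero_iff.1 this
  -- As the projection kills `x` and fixes `f`, this reads `‖f‖ ≤ ‖x - f‖ < ε / 2`, and so `‖x‖ <
  -- ε`.
  have h1 := FBL.norm_proj_le (B : Set A) (x - BanachCompletion.of f)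
  rw [map_sub, h0, FBL.proj_of, hB, zero_sub, norm_neg] at h1
  rw [dist_eq_norm] at hf
  have h2 := norm_add_le (x - BanachCompletion.of f) (BanachCompletion.of f)
  rw [sub_add_cancel] at h2
  linarith

end Projection

/-! ### Order properties of `J` and real-valued lattice homomorphisms -/

section Representation

variable {A : Type u}

theorem isLatticeHom_J : IsLatticeHom (J A : FBL A →ₗ[ℝ] H A) := by
  constructor
  · refine BanachCompletion.induction₂ (isClosed_eq ?_ ?_) fun f g => ?_
    · exact (J A).continuous.comp continuous_sup
    · exact ((J A).continuous.comp continuous_fst).sup ((J A).continuous.comp continuous_snd)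
    · change J A _ = J A _ ⊔ J A _
      rw [← BanachCompletion.of_sup, J_of, J_of, J_of]
      rfl
  · refine BanachCompletion.induction₂ (isClosed_eq ?_ ?_) fun f g => ?_
    · exact (J A).continuous.comp continuous_inf
    · exact ((J A).continuous.comp continuous_fst).inf ((J A).continuous.comp continuous_snd)
    · change J A _ = J A _ ⊓ J A _
      rw [← BanachCompletion.of_inf, J_of, J_of, J_of]
      rfl

theorem J_sup (f g : FBL A) : J A (f ⊔ g) = J A f ⊔ J A g := isLatticeHom_J.map_sup f g

theorem J_inf (f g : FBL A) : J A (f ⊓ g) = J A f ⊓ J A g := isLatticeHom_J.map_inf f g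

/-- The order is encoded by `f ⊔ g = g`, an equation that an injective lattice homomorphism both
preserves and reflects. -/
theorem J_le_J_iff (f g : FBL A) : J A f ≤ J A g ↔ f ≤ g := by
  rw [← sup_eq_right, ← J_sup, J_injective.eq_iff, sup_eq_right]

theorem isSublattice_range_J : IsSublattice (Set.range (J A)) := by
  constructor
  · rintro _ ⟨f, rfl⟩ _ ⟨g, rfl⟩
    exact ⟨f ⊔ g, J_sup f g⟩
  · rintro _ ⟨f, rfl⟩ _ ⟨g, rfl⟩
    exact ⟨f ⊓ g, J_inf f g⟩

theorem norm_J_le (f : FBL A) : ‖J A f‖ ≤ ‖f‖ := by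
  refine BanachCompletion.induction₁ (p := fun x => ‖J A x‖ ≤ ‖x‖)
    (isClosed_le (J A).continuous.norm continuous_norm) (fun f => ?_) f
  rw [J_of, LinearIsometry.norm_map, ← one_mul ‖f‖]
  exact norm_restrict_le f

/-- Evaluation of elements of `H(Δ_A)` at a point of the cube. -/
def H.evalAt (ξ : Cube A) : H A →ₗ[ℝ] ℝ where
  toFun f := f ξ
  map_add' _ _ := rfl
  map_smul' _ _ := rfl

theorem continuous_J_apply (ξ : Cube A) : Continuous fun f : FBL A => J A f ξ :=
  (continuous_eval_const ξ).comp (continuous_subtype_val.comp (J A).continuous)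

theorem isLatticeHom_of_eq_mul_J {ω : FBL A →ₗ[ℝ] ℝ} {ξ : Cube A} {c : ℝ} (hc : 0 ≤ c)
    (h : ∀ f, ω f = c * J A f ξ) : IsLatticeHom ω := by
  constructor
  · intro f g
    rw [h, h, h, J_sup, H.sup_apply, mul_max_of_nonneg _ _ hc]
  · intro f g
    rw [h, h, h, J_inf, H.inf_apply, mul_min_of_nonneg _ _ hc]

/-- The values on the generators form a bounded point `η` of `ℝ^A`, and `ω` is evaluation at `η`.
Dividing `η` by a bound `c` for `ω` puts it in the cube, and positive homogeneity returns `c` as the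
scalar factor. -/
theorem IsLatticeHom.exists_eq_mul_J {ω : FBL A →ₗ[ℝ] ℝ} (hω : IsLatticeHom ω) :
    ∃ (ξ : Cube A) (c : ℝ), 0 ≤ c ∧ ∀ f : FBL A, ω f = c * J A f ξ := by
  obtain ⟨C, hC⟩ := exists_bound_of_nonneg ω fun y hy => by
    rw [← abs_of_nonneg hy, hω.map_abs]
    exact abs_nonneg _
  -- The maximum with `1` secures `c > 0`, needed for the division by `c`, even when `ω = 0`.
  let c : ℝ := max C 1
  have hc : 0 < c := lt_max_of_lt_right one_pos
  have hωc : ∀ y, ‖ω y‖ ≤ c * ‖y‖ := fun y =>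
    (hC y).trans (mul_le_mul_of_nonneg_right (le_max_left _ _) (norm_nonneg y))
  let η : A → ℝ := fun a => ω (FBL.gen a)
  have hη : ∀ a, |η a| ≤ c := fun a => (hωc _).trans (by
    rw [FBL.gen, LinearIsometry.norm_map]
    exact mul_le_of_le_one_right hc.le (FVL.norm_gen_le a))
  let ξ : Cube A := ⟨c⁻¹ • η, fun a _ => abs_le.1 (by
    rw [Pi.smul_apply, smul_eq_mul, abs_mul, abs_of_nonneg (inv_nonneg.2 hc.le)]
    exact inv_mul_le_one_of_le₀ (hη a) hc.le)⟩
  have hξ : η = c • (ξ : A → ℝ) := (smul_inv_smul₀ hc.ne' _).symm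
  -- Both sides respect the linear and lattice operations in `f` and agree on the generators.
  have hω_of : ∀ f : FVL A, ω (BanachCompletion.of f) = f.eval η := fun f => by
    induction f using FVL.induction with
    | gen a => rfl
    | zero => rw [map_zero, map_zero, FVL.eval_zero]
    | add f g hf hg => rw [map_add, map_add, hf, hg, FVL.eval_add]
    | smul c f hf => rw [map_smul, map_smul, hf, FVL.eval_smul, smul_eq_mul]
    | sup f g hf hg => rw [BanachCompletion.of_sup, hω.map_sup, hf, hg, FVL.eval_sup]
    | inf f g hf hg => rw [BanachCompletion.of_inf, hω.map_inf, hf, hg, FVL.eval_inf]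
  refine ⟨ξ, c, hc.le, BanachCompletion.induction₁ (isClosed_eq ?_ ?_) fun f => ?_⟩
  · exact (ω.mkContinuous c hωc).continuous
  · exact continuous_const.mul (continuous_J_apply ξ)
  · rw [hω_of, J_of, hξ, FVL.eval_pos_smul f c hc.le]
    rfl

theorem exists_isLatticeHom_ne {f g : FBL A} (h : f ≠ g) :
    ∃ ω : FBL A →ₗ[ℝ] ℝ, IsLatticeHom ω ∧ ω f ≠ ω g := by
  by_contra! hcon
  refine h (J_injective (H.ext fun ξ => ?_))
  exact hcon ((H.evalAt ξ).comp (J A : FBL A →ₗ[ℝ] H A))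
    (isLatticeHom_of_eq_mul_J zero_le_one fun f => (one_mul _).symm)

end Representation

/-! ### Finite `A`: norm equivalence and surjectivity -/

section Finite

variable {A : Type u}

theorem norm_le_card_mul_norm_J [Finite A] (f : FBL A) : ‖f‖ ≤ Nat.card A * ‖J A f‖ := by
  have := Fintype.ofFinite A
  have hproj : FBL.proj ((Finset.univ : Finset A) : Set A) f = f := by
    refine BanachCompletion.induction₁ (p := fun f => FBL.proj _ f = f)
      (isClosed_eq (FBL.proj _).continuous continuous_id) (fun f => ?_) f
    rw [FBL.proj_of]
    congr 1
    refine FVL.ext fun ξ => ?_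
    rw [FVL.eval_proj, Finset.coe_univ, Set.indicator_univ]
  have := FBL.norm_proj_le_card_mul (Finset.univ : Finset A) f
  rwa [hproj, Finset.card_univ, ← Nat.card_eq_fintype_card] at this

/-- On the unit sphere of `ℝ^A` for the supremum norm, every continuous function is a uniform limit
of elements of `FVL A`. -/
theorem FVL.exists_abs_sub_lt_on_sphere [Fintype A] [Nonempty A]
    (h : C(Metric.sphere (0 : A → ℝ) 1, ℝ)) {ε : ℝ} (hε : 0 < ε) :
    ∃ f : FVL A, ∀ ξ : Metric.sphere (0 : A → ℝ) 1, |h ξ - f.eval ξ| < ε := by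
  classical
  let R : FVL A → C(Metric.sphere (0 : A → ℝ) 1, ℝ) := fun f =>
    ⟨fun ξ => f.eval ξ, f.continuous_eval.comp continuous_subtype_val⟩
  -- On `ℝ^A` this is the supremum norm, so on the sphere it plays the role of the constant function
  -- `1`, which `FVL A` does not contain.
  let e : FVL A := Finset.univ.sup' Finset.univ_nonempty fun a => |FVL.gen a|
  have he : ∀ ξ : Metric.sphere (0 : A → ℝ) 1, e.eval ξ = 1 := fun ξ => by
    have h1 : e.eval ξ = Finset.univ.sup' Finset.univ_nonempty fun a => |(ξ : A → ℝ) a| :=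
      Finset.apply_sup'_eq_sup'_comp Finset.univ_nonempty (fun f : FVL A => f.eval ξ)
        (fun _ _ => rfl)
    have h2 : ‖(ξ : A → ℝ)‖ = 1 := mem_sphere_zero_iff_norm.1 ξ.2
    refine h1.trans (Eq.trans ?_ h2)
    refine le_antisymm (Finset.sup'_le _ _ fun a _ => norm_le_pi_norm (ξ : A → ℝ) a) ?_
    exact (pi_norm_le_iff_of_nonempty _).2 fun a =>
      Finset.le_sup' (fun a => |(ξ : A → ℝ) a|) (Finset.mem_univ a)
  have hsep : (Set.range R).SeparatesPointsStrongly := by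
    intro v x y
    by_cases hxy : x = y
    · subst hxy
      have : (R (v x • e)) x = v x := by
        change (v x • e).eval x = v x
        rw [FVL.eval_smul, he, mul_one]
      exact ⟨_, ⟨_, rfl⟩, this, this⟩
    · obtain ⟨a, ha⟩ := Function.ne_iff.1 (Subtype.coe_injective.ne hxy)
      have ha' : (x : A → ℝ) a - (y : A → ℝ) a ≠ 0 := sub_ne_zero.2 ha
      -- Two-point interpolation: `d` is the slope in the coordinate `a`, and the multiple of `e`
      -- adjusts the additive constant.
      let d : ℝ := (v x - v y) / ((x : A → ℝ) a - (y : A → ℝ) a)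
      refine ⟨R (d • FVL.gen a + (v x - d * (x : A → ℝ) a) • e), ⟨_, rfl⟩, ?_, ?_⟩
      · change (d • FVL.gen a + (v x - d * (x : A → ℝ) a) • e).eval x = v x
        simp [he]
      · change (d • FVL.gen a + (v x - d * (x : A → ℝ) a) • e).eval y = v y
        have : d * ((x : A → ℝ) a - (y : A → ℝ) a) = v x - v y := div_mul_cancel₀ _ ha'
        simp only [FVL.eval_add, FVL.eval_smul, FVL.eval_gen, he]
        linarith
  -- Stone–Weierstrass in its lattice form: closure under `⊓` and `⊔` with interpolation at pairs of
  -- points is enough, and no products are required.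
  have hdense := ContinuousMap.sublattice_closure_eq_top (Set.range R) ⟨R 0, 0, rfl⟩
    (by
      rintro _ ⟨f, rfl⟩ _ ⟨g, rfl⟩
      exact ⟨f ⊓ g, rfl⟩)
    (by
      rintro _ ⟨f, rfl⟩ _ ⟨g, rfl⟩
      exact ⟨f ⊔ g, rfl⟩) hsep
  have hh : h ∈ closure (Set.range R) := hdense ▸ Set.mem_univ h
  obtain ⟨_, ⟨f, rfl⟩, hf⟩ := Metric.mem_closure_iff.1 hh ε hε
  refine ⟨f, fun ξ => lt_of_le_of_lt ?_ hf⟩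
  exact ContinuousMap.dist_apply_le_dist (f := h) (g := R f) ξ

/-- A positively homogeneous function on the cube is determined by its values on the unit sphere of
the supremum norm, and its modulus is largest there. Uniform approximation on the sphere is
therefore uniform approximation on the cube. -/
theorem denseRange_restrict [Finite A] [Nonempty A] :
    DenseRange (restrict : FVL A → H A) := by
  have := Fintype.ofFinite A
  refine fun h => Metric.mem_closure_iff.2 fun ε hε => ?_
  have hcube : ∀ {ξ : A → ℝ}, ‖ξ‖ ≤ 1 → ξ ∈ Cube A := fun {ξ} hξ a _ =>
    abs_le.1 ((norm_le_pi_norm ξ a).trans hξ)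
  let ι : Metric.sphere (0 : A → ℝ) 1 → Cube A := fun ξ =>
    ⟨ξ, hcube (mem_sphere_zero_iff_norm.1 ξ.2).le⟩
  have hι : Continuous ι := continuous_subtype_val.subtype_mk _
  obtain ⟨f, hf⟩ := FVL.exists_abs_sub_lt_on_sphere (h.toFun.comp ⟨ι, hι⟩) (half_pos hε)
  refine ⟨restrict f, ⟨f, rfl⟩, ?_⟩
  rw [dist_eq_norm]
  refine lt_of_le_of_lt ?_ (half_lt_self hε)
  rw [H.norm_def]
  refine (ContinuousMap.norm_le _ (half_pos hε).le).2 fun ξ => ?_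
  set g : H A := h - restrict f with hg
  have hg_sphere : ∀ η, |g (ι η)| ≤ ε / 2 := fun η => (hf η).le
  have hξ1 : ‖(ξ : A → ℝ)‖ ≤ 1 :=
    (pi_norm_le_iff_of_nonneg zero_le_one).2 fun a => abs_le.2 (ξ.2 a (Set.mem_univ a))
  change |g ξ| ≤ ε / 2
  by_cases hξ : (ξ : A → ℝ) = 0
  -- The origin has no radial projection to the sphere; homogeneity with `t = 0` forces `g` to
  -- vanish there.
  · have h0 : g ξ = 0 * g ξ := g.2 0 le_rfl zero_le_one ξ ξ (by rw [hξ, smul_zero])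
    rw [h0, zero_mul, abs_zero]
    exact (half_pos hε).le
  · let η : Metric.sphere (0 : A → ℝ) 1 := ⟨‖(ξ : A → ℝ)‖⁻¹ • (ξ : A → ℝ), by
      rw [mem_sphere_zero_iff_norm, norm_smul, norm_inv, norm_norm,
        inv_mul_cancel₀ (norm_ne_zero_iff.2 hξ)]⟩
    have h1 : g ξ = ‖(ξ : A → ℝ)‖ * g (ι η) :=
      g.2 _ (norm_nonneg _) hξ1 (ι η) ξ (smul_inv_smul₀ (norm_ne_zero_iff.2 hξ) _).symm
    rw [h1, abs_mul, abs_of_nonneg (norm_nonneg _)]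
    exact (mul_le_of_le_one_left (abs_nonneg _) hξ1).trans (hg_sphere η)

/-- The lower bound `‖f‖ ≤ n ‖Jf‖` and completeness of `FBL A` make the range closed. It is dense
because it contains the restrictions of `FVL A`. -/
theorem J_surjective [Finite A] [Nonempty A] : Function.Surjective (J A) := by
  have hanti : AntilipschitzWith (Nat.card A : NNReal) (J A) :=
    (J A).antilipschitz_of_bound fun f => by
      simpa using norm_le_card_mul_norm_J f
  have hclosed := hanti.isClosed_range (J A).uniformContinuous
  have hdense : DenseRange (J A) := denseRange_restrict.mono <| by
    rintro _ ⟨f, rfl⟩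
    exact ⟨BanachCompletion.of f, J_of f⟩
  rw [← Set.range_eq_univ, ← hclosed.closure_eq]
  exact hdense.closure_range

end Finite

end FreeBanachLattice

end

open FreeBanachLattice in
theorem mainTheorem2 {A : Type*} [Nonempty A] :
    -- the real-valued lattice homomorphisms on `FBL(A)`
    (∀ ω : FBL A →ₗ[ℝ] ℝ, IsLatticeHom ω ↔
      ∃ (ξ : Cube A) (c : ℝ), 0 ≤ c ∧ ∀ f : FBL A, ω f = c * J A f ξ) ∧
    -- they separate the points of `FBL(A)`
    (∀ f g : FBL A, f ≠ g → ∃ ω : FBL A →ₗ[ℝ] ℝ, IsLatticeHom ω ∧ ω f ≠ ω g) ∧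
    -- `J` is an injective lattice homomorphism, and a linear order isomorphism onto its range,
    -- a vector sublattice of `H(Δ_A)`
    IsLatticeHom (J A : FBL A →ₗ[ℝ] H A) ∧
    Function.Injective (J A) ∧
    IsSublattice (Set.range (J A)) ∧
    (∀ f g : FBL A, J A f ≤ J A g ↔ f ≤ g) ∧
    -- for finite `A`, `J` is a surjective isomorphism, with explicit constants
    (Finite A →
      (∃ e : FBL A ≃L[ℝ] H A, ∀ f, e f = J A f) ∧
      ∀ f : FBL A, ‖J A f‖ ≤ ‖f‖ ∧ ‖f‖ ≤ Nat.card A * ‖J A f‖) := by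
  refine ⟨fun ω => ⟨fun hω => hω.exists_eq_mul_J, ?_⟩, fun f g h => exists_isLatticeHom_ne h,
    isLatticeHom_J, J_injective, isSublattice_range_J, J_le_J_iff, fun _ => ⟨?_, ?_⟩⟩
  · rintro ⟨ξ, c, hc, h⟩
    exact isLatticeHom_of_eq_mul_J hc h
  -- Continuity of the inverse is the open mapping theorem, both spaces being complete.
  · exact ⟨ContinuousLinearEquiv.ofBijective (J A) (LinearMap.ker_eq_bot.2 J_injective)
      (LinearMap.range_eq_top.2 J_surjective), fun _ => rfl⟩
  · exact fun f => ⟨norm_J_le f, norm_le_card_mul_norm_J f⟩
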